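/- Let $n\ge 1$, $q\in\mathbb{R}^M$ with $q_j>0$ for all $j$, and for $k=1,\dots,n$ let $A^k\in\mathbb{R}^{m_k\times M}$, $b^k\in\mathbb{R}^{m_k}$. Let $\Delta_M$ be the probability simplex, $\mathcal C^k=\{x\in\Delta_M : A^kx=b^k\}$ and $\mathcal C=\bigcap_{k=1}^n\mathcal C^k$, and assume $\mathcal C\neq\emptyset$. Write $$\mathrm{KL}(p,r)=\sum_{j}\Big(p_j\log\frac{p_j}{r_j}-p_j+r_j\Big)$$ if $p,r\ge0$ and $r_j=0\Rightarrow p_j=0$ (with $0\log 0=0\log\frac00=0$), and $\mathrm{KL}(p,r)=\infty$ otherwise; let $P^{\mathrm{KL}}_S(r)=\operatorname{argmin}_{p\in S}\mathrm{KL}(p,r)$. Let $I\subset\{1,\dots,n\}$. For $k\in I$ replace $(A^k,b^k)$ by a normalized system $(\hat A^k,\hat b^k)$ as follows: choose $\xi_k,\xi_k'$ such that all entries of $A^k-\xi_k$ and $b^k-\xi_k$ (entrywise subtraction) are nonnegative and $\xi'_k$ is at least every column sum of $A^k-\xi_k$ and at least the sum of the entries of $b^k-\xi_k$ (for instance $\xi_k=\min\{\min_{ij}A^k_{ij},\min_i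 b^k_i\}$ and $\xi_k'$ the maximum of these sums); divide $A^k-\xi_k$ and $b^k-\xi_k$ by $\xi'_k$ (if $\xi_k'=0$, both are zero and remain zero); delete the rows in which all entries and the right-hand side vanish; finally append one row making all column sums of $\hat A^k$ and the sum of the entries of $\hat b^k$ equal to $1$. Extend the index $k$ of $A^k,b^k,\hat A^k,\hat b^k,\mathcal C^k$ periodically with period $n$, and consider the iteration $p^{(0)}=q$ and, for $k=1,2,\dots$, $$p^{(k)}_j=p^{(k-1)}_j\prod_{i}\Big(\frac{\hat b^k_i}{(\hat A^kp^{(k-1)})_i}\Big)^{\hat A^k_{ij}}\ (j=1,\dots,M)\quad\text{if } k\in I+n\mathbb{N}_0,\qquad p^{(k)}=P^{\mathrm{KL}}_{\mathcal C^k}(p^{(k-1)})\quad\text{otherwise,}$$ with the conventions $0^0=1$ and $\frac00=0$. (For $\hat b^k>0$ the first case is $p^{(k-1)}\odot\exp\big((\hat A^k)^{\top}\log\frac{\hat b^k}{\hat A^kp^{(k-1)}}\big)$.) Then the iteration is well defined (every projection in it exists and is unique), the projection $P^{\mathrm{KL}}_{\mathcal C}(q)$ exists and is unique, and $$\lim_{k\to\infty}p^{(k)}=P^{\mathrm{KL}}_{\mathcal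 C}(q)=\operatorname*{argmin}_{p\in\mathcal C}\mathrm{KL}(p,q).$$ -/

import Mathlib

open Filter Topology

namespace KLMix

/-- The Kullback–Leibler divergence of two real vectors, with values in `ℝ ∪ {∞}`. The conventions
`0 log 0 = 0 log (0/0) = 0` hold since the factor in front of the logarithm is `0`. -/
noncomputable def KL {M : ℕ} (p q : Fin M → ℝ) : EReal :=
  open Classical in
  if (∀ j, 0 ≤ p j) ∧ (∀ j, 0 ≤ q j) ∧ (∀ j, q j = 0 → p j = 0) then
    ((∑ j, (p j * Real.log (p j / q j) - p j + q j) : ℝ) : EReal)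
  else ⊤

/-- `C(A, b)`: the affine subset `{x ∈ Δ_M : A x = b}` of the probability simplex. -/
def affineSubset {m M : ℕ} (A : Matrix (Fin m) (Fin M) ℝ) (b : Fin m → ℝ) : Set (Fin M → ℝ) :=
  {x | x ∈ stdSimplex ℝ (Fin M) ∧ A.mulVec x = b}

/-- `x` is a KL (information) projection of `r` onto `S`, that is, `x ∈ argmin_{p ∈ S} KL(p, r)`. -/
def IsKLProj {M : ℕ} (S : Set (Fin M → ℝ)) (r x : Fin M → ℝ) : Prop :=
  x ∈ S ∧ ∀ y ∈ S, KL x r ≤ KL y r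

section Normalization

variable {m M : ℕ}

/-- The shifted and rescaled matrix `(A - ξ) / ξ'` (entrywise). -/
noncomputable def scaledMatrix (A : Matrix (Fin m) (Fin M) ℝ) (ξ ξ' : ℝ) :
    Matrix (Fin m) (Fin M) ℝ :=
  Matrix.of fun i j => (1 / ξ') * (A i j - ξ)

/-- The shifted and rescaled right-hand side `(b - ξ) / ξ'` (entrywise). -/
noncomputable def scaledRhs (b : Fin m → ℝ) (ξ ξ' : ℝ) : Fin m → ℝ :=
  fun i => (1 / ξ') * (b i - ξ)

/-- The values of shift `ξ` and scale `ξ'` that may be used to normalize the system `A x = b`: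
after subtracting `ξ` all entries of `A` and `b` are nonnegative, and `ξ'` is at least every
column sum of the shifted matrix and at least the sum of the shifted right-hand side.
(`ξ' = 0` is possible only if the shifted system is `0 = 0`.) -/
structure IsAdmissible (A : Matrix (Fin m) (Fin M) ℝ) (b : Fin m → ℝ) (ξ ξ' : ℝ) : Prop where
  shift_le_matrix : ∀ i j, ξ ≤ A i j
  shift_le_rhs : ∀ i, ξ ≤ b i
  colSum_le_scale : ∀ j, ∑ i, (A i j - ξ) ≤ ξ'
  rhsSum_le_scale : ∑ i, (b i - ξ) ≤ ξ'

/-- The smallest-modification shift `ξ = min {min_{ij} A_{ij}, min_i b_i}`. -/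
noncomputable def minShift (A : Matrix (Fin m) (Fin M) ℝ) (b : Fin m → ℝ) : ℝ :=
  min (⨅ i, ⨅ j, A i j) (⨅ i, b i)

/-- The scale `ξ' = max {max_j (𝟙ᵀ A⁽¹⁾)_j, 𝟙ᵀ b⁽¹⁾}` belonging to the shift `ξ = minShift A b`,
where `A⁽¹⁾ = A - ξ` and `b⁽¹⁾ = b - ξ`. -/
noncomputable def minScale (A : Matrix (Fin m) (Fin M) ℝ) (b : Fin m → ℝ) : ℝ :=
  max (⨆ j, ∑ i, (A i j - minShift A b)) (∑ i, (b i - minShift A b))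

/-- The standard choice of shift and scale is admissible. -/
theorem isAdmissible_min (A : Matrix (Fin m) (Fin M) ℝ) (b : Fin m → ℝ) :
    IsAdmissible A b (minShift A b) (minScale A b) where
  shift_le_matrix i j :=
    (min_le_left _ _).trans
      ((ciInf_le (Set.finite_range _).bddBelow i).trans
        (ciInf_le (Set.finite_range fun j => A i j).bddBelow j))
  shift_le_rhs i := (min_le_right _ _).trans (ciInf_le (Set.finite_range _).bddBelow i)
  colSum_le_scale j :=
    (le_ciSup (f := fun j => ∑ i, (A i j - minShift A b)) (Set.finite_range _).bddAbove j).trans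
      (le_max_left _ _)
  rhsSum_le_scale := le_max_right _ _

/-- The rows of the normalized system: the rows of the scaled system in which not all entries
(including the right-hand side) vanish, together with one additional row `none`. -/
abbrev NormRow (A : Matrix (Fin m) (Fin M) ℝ) (b : Fin m → ℝ) (ξ ξ' : ℝ) : Type :=
  Option {i : Fin m // ¬ ((∀ j, scaledMatrix A ξ ξ' i j = 0) ∧ scaledRhs b ξ ξ' i = 0)}

noncomputable instance instFintypeNormRow (A : Matrix (Fin m) (Fin M) ℝ) (b : Fin m → ℝ)
    (ξ ξ' : ℝ) : Fintype (NormRow A b ξ ξ') :=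
  Fintype.ofFinite _

/-- The normalized matrix; the additional row complements the column sums to `1`. -/
noncomputable def normMatrix (A : Matrix (Fin m) (Fin M) ℝ) (b : Fin m → ℝ) (ξ ξ' : ℝ) :
    Matrix (NormRow A b ξ ξ') (Fin M) ℝ :=
  Matrix.of fun r j =>
    match r with
    | some i => scaledMatrix A ξ ξ' i.1 j
    | none => 1 - ∑ i, scaledMatrix A ξ ξ' i j

/-- The normalized right-hand side; the additional entry complements the sum to `1`. -/
noncomputable def normRhs (A : Matrix (Fin m) (Fin M) ℝ) (b : Fin m → ℝ) (ξ ξ' : ℝ) :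
    NormRow A b ξ ξ' → ℝ :=
  fun r =>
    match r with
    | some i => scaledRhs b ξ ξ' i.1
    | none => 1 - ∑ i, scaledRhs b ξ ξ' i

end Normalization

/-- One generalized iterative scaling (SMART) step
`p ⊙ exp (Aᵀ log (b / (A p))) = p ⊙ ∏ i, (b / (A p))_i ^ A_{i,:}`, in the product form, which makes
sense also when `b` has zero entries (`0 ^ 0 = 1`, and `0 ^ a = 0` for `a > 0`). -/
noncomputable def gisStep {ι : Type} [Fintype ι] {M : ℕ} (A : Matrix ι (Fin M) ℝ) (b : ι → ℝ)
    (p : Fin M → ℝ) : Fin M → ℝ :=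
  fun j => p j * ∏ i, (b i / A.mulVec p i) ^ (A i j)

/-- `p⁽⁰⁾, p⁽¹⁾, …` is a run of the cyclic scheme started at `q`. The `n` blocks are indexed from
`0`, so that step `k + 1` (from `p⁽ᵏ⁾` to `p⁽ᵏ⁺¹⁾`) uses block `k mod n`: a single GIS step for the
normalized system if that block lies in `I`, and an exact KL projection otherwise. -/
structure IsRun {n M : ℕ} [NeZero n] {m : Fin n → ℕ} (q : Fin M → ℝ) (I : Set (Fin n))
    (A : (k : Fin n) → Matrix (Fin (m k)) (Fin M) ℝ) (b : (k : Fin n) → Fin (m k) → ℝ)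
    (ξ ξ' : Fin n → ℝ) (p : ℕ → Fin M → ℝ) : Prop where
  init : p 0 = q
  gis : ∀ k : ℕ, ∀ i : Fin n, i = Fin.ofNat n k → i ∈ I →
    p (k + 1) = gisStep (normMatrix (A i) (b i) (ξ i) (ξ' i)) (normRhs (A i) (b i) (ξ i) (ξ' i)) (p k)
  proj : ∀ k : ℕ, ∀ i : Fin n, i = Fin.ofNat n k → i ∉ I →
    IsKLProj (affineSubset (A i) (b i)) (p k) (p (k + 1))

end KLMix

/-! Each step, of either kind, lowers `KL(x, p⁽ᵏ⁾)` by an amount `Δ k ≥ 0` that does not depend on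
`x ∈ 𝒞`. For an exact projection this is the Pythagorean identity (`pythagoras_affineSubset`), an
equality because the set is affine on the support of its minimizer. For a GIS step, taking
logarithms of the product gives `KL(b̂, Âp) + (1 - ∑ p')` (`klSum_sub_klSum_gisStep`), where
weighted AM-GM makes the second term nonnegative. The gains telescope against `KL(x, q)`, so they
are summable and tend to zero. A vanishing gain forces a limit of iterates to satisfy the current
block and the next iterate to share that limit (`tendsto_of_tendsto_stepGain`). A cluster point `y`
therefore survives a full cycle and lies in `𝒞`. Since `KL(y, p⁽ᵏ⁾)` decreases and tends to zero
along the cluster filter, it tends to zero outright, whence `p⁽ᵏ⁾ → y`. Equal gains give `KL(y, q) -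
KL(x, q) = KL(y, p⁽ᵏ⁾) - KL(x, p⁽ᵏ⁾) ≤ KL(y, p⁽ᵏ⁾) → 0`, so `y` is the projection
(`exists_tendsto_of_equal_gain`). Boundary zeros are handled by the Hellinger bound
`sq_sqrt_sub_sqrt_le_klTerm` and by carrying the invariant that the support of each `p⁽ᵏ⁾` contains
that of every point of `𝒞`. -/

namespace KLMix

/-! ### Real-valued divergence: Hellinger bound, continuity, limits -/

/-- The summand of the Kullback–Leibler divergence. -/
noncomputable def klTerm (a b : ℝ) : ℝ := a * Real.log (a / b) - a + b

/-- The real-valued formula for the Kullback–Leibler divergence. -/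
noncomputable def klSum {ι : Type*} [Fintype ι] (p r : ι → ℝ) : ℝ := ∑ j, klTerm (p j) (r j)

/-- This is `log t ≤ t - 1` at `t = √b / √a`. It turns small divergence into closeness in either
argument, uniformly up to the boundary. -/
theorem sq_sqrt_sub_sqrt_le_klTerm {a b : ℝ} (ha : 0 ≤ a) (hb : 0 ≤ b) (hab : b = 0 → a = 0) :
    (√a - √b) ^ 2 ≤ klTerm a b := by
  unfold klTerm
  rcases ha.eq_or_lt with rfl | ha'
  · simp [Real.sq_sqrt hb]
  have hb' : 0 < b := hb.lt_of_ne fun h => ha'.ne' (hab h.symm)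
  have hsa := Real.sqrt_pos.2 ha'
  have hsb := Real.sqrt_pos.2 hb'
  have h1 : Real.log (a / b) = -(2 * Real.log (√b / √a)) := by
    rw [Real.log_div ha'.ne' hb'.ne', Real.log_div hsb.ne' hsa.ne', Real.log_sqrt hb,
      Real.log_sqrt ha]
    ring
  have h2 := Real.log_le_sub_one_of_pos (div_pos hsb hsa)
  have h3 : a * (√b / √a) = √a * √b := by
    rw [mul_div_assoc', div_eq_iff hsa.ne']
    nlinarith [Real.sq_sqrt ha]
  have h4 : a * Real.log (√b / √a) ≤ √a * √b - a := by
    nlinarith [mul_le_mul_of_nonneg_left h2 ha]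
  rw [h1]
  nlinarith [Real.sq_sqrt ha, Real.sq_sqrt hb]

theorem klTerm_nonneg {a b : ℝ} (ha : 0 ≤ a) (hb : 0 ≤ b) (hab : b = 0 → a = 0) :
    0 ≤ klTerm a b :=
  (sq_nonneg _).trans (sq_sqrt_sub_sqrt_le_klTerm ha hb hab)

theorem klTerm_self {a : ℝ} : klTerm a a = 0 := by
  by_cases h : a = 0 <;> simp [klTerm, h]

theorem mul_log_div_chain {a b c : ℝ} (hab : b = 0 → a = 0) (hac : c = 0 → a = 0) :
    a * Real.log (a / c) = a * Real.log (a / b) + a * Real.log (b / c) := by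
  by_cases ha : a = 0
  · simp [ha]
  have hb : b ≠ 0 := fun h => ha (hab h)
  have hc : c ≠ 0 := fun h => ha (hac h)
  rw [Real.log_div ha hc, Real.log_div ha hb, Real.log_div hb hc]
  ring

/-- The chain rule for logarithms splits both terms through the mixture `z`; the linear parts
cancel. -/
theorem klTerm_convex_identity {a c r t : ℝ} (ha : 0 ≤ a) (hc : 0 ≤ c) (har : r = 0 → a = 0)
    (hcr : r = 0 → c = 0) (ht : 0 < t) (ht1 : t < 1) :
    (1 - t) * klTerm a r + t * klTerm c r = klTerm ((1 - t) * a + t * c) r +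
      ((1 - t) * klTerm a ((1 - t) * a + t * c) + t * klTerm c ((1 - t) * a + t * c)) := by
  set z := (1 - t) * a + t * c with hz
  have h1 : 0 ≤ (1 - t) * a := mul_nonneg (by linarith) ha
  have h2 : 0 ≤ t * c := mul_nonneg ht.le hc
  have hza : z = 0 → a = 0 := fun h => by
    have : (1 - t) * a = 0 := by linarith
    exact (mul_eq_zero.1 this).resolve_left (by linarith)
  have hzc : z = 0 → c = 0 := fun h => by
    have : t * c = 0 := by linarith
    exact (mul_eq_zero.1 this).resolve_left ht.ne'
  unfold klTerm
  rw [mul_log_div_chain hza har, mul_log_div_chain hzc hcr]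
  have : z * Real.log (z / r) = (1 - t) * (a * Real.log (z / r)) + t * (c * Real.log (z / r)) := by
    conv_lhs => rw [hz]
    ring
  rw [this]
  ring

theorem continuous_klTerm_left (r : ℝ) : Continuous fun a => klTerm a r := by
  by_cases hr : r = 0
  -- Division by zero gives `klTerm a 0 = -a`, still continuous.
  · simpa [klTerm, hr] using continuous_neg
  have h : (fun a => klTerm a r) = fun a => r * (a / r * Real.log (a / r)) - a + r := by
    funext a
    unfold klTerm
    field_simp
  rw [h]
  have := Real.continuous_mul_log.comp (continuous_id.div_const r)
  exact ((continuous_const.mul this).sub continuous_id).add continuous_const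

theorem tendsto_klTerm_right {α : Type*} {l : Filter α} {f : α → ℝ} {a : ℝ}
    (hf : Tendsto f l (𝓝 a)) : Tendsto (fun k => klTerm a (f k)) l (𝓝 0) := by
  rw [← klTerm_self (a := a)]
  unfold klTerm
  refine Tendsto.add (Tendsto.sub ?_ tendsto_const_nhds) hf
  by_cases ha : a = 0
  · simpa [ha] using tendsto_const_nhds
  refine Tendsto.const_mul _ ((Tendsto.log ?_ (by simp [ha])))
  exact tendsto_const_nhds.div hf ha

variable {ι : Type*} [Fintype ι]

theorem klSum_nonneg {p r : ι → ℝ} (hp : ∀ j, 0 ≤ p j) (hr : ∀ j, 0 ≤ r j)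
    (h : ∀ j, r j = 0 → p j = 0) : 0 ≤ klSum p r :=
  Finset.sum_nonneg fun j _ => klTerm_nonneg (hp j) (hr j) (h j)

theorem klTerm_le_klSum {p r : ι → ℝ} (hp : ∀ j, 0 ≤ p j) (hr : ∀ j, 0 ≤ r j)
    (h : ∀ j, r j = 0 → p j = 0) (j : ι) : klTerm (p j) (r j) ≤ klSum p r :=
  Finset.single_le_sum (f := fun j => klTerm (p j) (r j))
    (fun j _ => klTerm_nonneg (hp j) (hr j) (h j)) (Finset.mem_univ j)

theorem continuous_klSum_left (r : ι → ℝ) : Continuous fun p => klSum p r :=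
  continuous_finsetSum _ fun j _ => (continuous_klTerm_left (r j)).comp (continuous_apply j)

theorem tendsto_klSum_right {α : Type*} {l : Filter α} {f : α → ι → ℝ} {a : ι → ℝ}
    (hf : Tendsto f l (𝓝 a)) : Tendsto (fun k => klSum a (f k)) l (𝓝 0) := by
  rw [← Finset.sum_const_zero (ι := ι) (s := Finset.univ)]
  exact tendsto_finsetSum _ fun j _ => tendsto_klTerm_right (tendsto_pi_nhds.1 hf j)

theorem tendsto_sqrt_sub_sqrt_of_klSum {α : Type*} {l : Filter α} {f g : α → ι → ℝ}
    (hf : ∀ k j, 0 ≤ f k j) (hg : ∀ k j, 0 ≤ g k j)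
    (h : ∀ᶠ k in l, ∀ j, g k j = 0 → f k j = 0)
    (hlim : Tendsto (fun k => klSum (f k) (g k)) l (𝓝 0)) (j : ι) :
    Tendsto (fun k => √(f k j) - √(g k j)) l (𝓝 0) := by
  have : Tendsto (fun k => (√(f k j) - √(g k j)) ^ 2) l (𝓝 0) := by
    refine squeeze_zero' (Eventually.of_forall fun k => sq_nonneg _) ?_ hlim
    filter_upwards [h] with k hk
    exact (sq_sqrt_sub_sqrt_le_klTerm (hf k j) (hg k j) (hk j)).trans
      (klTerm_le_klSum (hf k) (hg k) hk j)
  have h2 := this.sqrt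
  simp only [Real.sqrt_sq_eq_abs, Real.sqrt_zero] at h2
  exact (tendsto_zero_iff_abs_tendsto_zero _).2 h2

/-- If `KL(f, g) → 0` and `g` converges, then `f` has the same limit. -/
theorem tendsto_left_of_klSum {α : Type*} {l : Filter α} {f g : α → ι → ℝ} {y : ι → ℝ}
    (hf : ∀ k j, 0 ≤ f k j) (hg : ∀ k j, 0 ≤ g k j)
    (h : ∀ᶠ k in l, ∀ j, g k j = 0 → f k j = 0)
    (hlim : Tendsto (fun k => klSum (f k) (g k)) l (𝓝 0)) (hy : Tendsto g l (𝓝 y))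
    (hy0 : ∀ j, 0 ≤ y j) : Tendsto f l (𝓝 y) := by
  refine tendsto_pi_nhds.2 fun j => ?_
  have h1 := (tendsto_sqrt_sub_sqrt_of_klSum hf hg h hlim j).add (tendsto_pi_nhds.1 hy j).sqrt
  have h2 := h1.pow 2
  simpa [Real.sq_sqrt, hf, hy0] using h2

/-- If `KL(f, g) → 0` and `f` converges, then `g` has the same limit. -/
theorem tendsto_right_of_klSum {α : Type*} {l : Filter α} {f g : α → ι → ℝ} {y : ι → ℝ}
    (hf : ∀ k j, 0 ≤ f k j) (hg : ∀ k j, 0 ≤ g k j)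
    (h : ∀ᶠ k in l, ∀ j, g k j = 0 → f k j = 0)
    (hlim : Tendsto (fun k => klSum (f k) (g k)) l (𝓝 0)) (hy : Tendsto f l (𝓝 y))
    (hy0 : ∀ j, 0 ≤ y j) : Tendsto g l (𝓝 y) := by
  refine tendsto_pi_nhds.2 fun j => ?_
  have h1 := (tendsto_pi_nhds.1 hy j).sqrt.sub (tendsto_sqrt_sub_sqrt_of_klSum hf hg h hlim j)
  have h2 := h1.pow 2
  simpa [Real.sq_sqrt, hg, hy0] using h2

/-! ### Information projections onto convex sets -/

variable {M : ℕ}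

theorem KL_eq_coe {p r : Fin M → ℝ} (hp : ∀ j, 0 ≤ p j) (hr : ∀ j, 0 ≤ r j)
    (h : ∀ j, r j = 0 → p j = 0) : KL p r = (klSum p r : EReal) := by
  unfold KL
  rw [if_pos ⟨hp, hr, h⟩]
  rfl

/-- If some point of `S` has finite divergence from `r`, the KL projections of `r` onto `S` are
the minimizers of the real-valued divergence over the points of `S` dominated by `r`. -/
theorem isKLProj_iff {S : Set (Fin M → ℝ)} (hS : ∀ x ∈ S, ∀ j, 0 ≤ x j) {r : Fin M → ℝ}
    (hr : ∀ j, 0 ≤ r j) (hne : ∃ x ∈ S, ∀ j, r j = 0 → x j = 0) {x : Fin M → ℝ} :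
    IsKLProj S r x ↔ x ∈ S ∧ (∀ j, r j = 0 → x j = 0) ∧
      ∀ y ∈ S, (∀ j, r j = 0 → y j = 0) → klSum x r ≤ klSum y r := by
  constructor
  · rintro ⟨hx, hmin⟩
    obtain ⟨z, hz, hzr⟩ := hne
    have hxr : ∀ j, r j = 0 → x j = 0 := by
      by_contra hcon
      have h1 : KL x r = ⊤ := by
        unfold KL
        exact if_neg fun h => hcon h.2.2
      have h2 := hmin z hz
      rw [h1, KL_eq_coe (hS z hz) hr hzr, top_le_iff] at h2
      exact EReal.coe_ne_top _ h2
    refine ⟨hx, hxr, fun y hy hyr => ?_⟩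
    have h2 := hmin y hy
    rw [KL_eq_coe (hS x hx) hr hxr, KL_eq_coe (hS y hy) hr hyr] at h2
    exact EReal.coe_le_coe_iff.1 h2
  · rintro ⟨hx, hxr, hmin⟩
    refine ⟨hx, fun y hy => ?_⟩
    by_cases hyr : ∀ j, r j = 0 → y j = 0
    · rw [KL_eq_coe (hS x hx) hr hxr, KL_eq_coe (hS y hy) hr hyr]
      exact EReal.coe_le_coe_iff.2 (hmin y hy hyr)
    · have h1 : KL y r = ⊤ := by
        unfold KL
        exact if_neg fun h => hyr h.2.2
      rw [h1]
      exact le_top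

/-- For minimizers `x`, the divergence inequality `KL(y, r) ≥ KL(x, r) + KL(y, z_t)` along the
segment `z_t = (1 - t) x + t y`. -/
theorem klSum_segment_le {S : Set (Fin M → ℝ)} (hS : ∀ x ∈ S, ∀ j, 0 ≤ x j) (hconv : Convex ℝ S)
    {r x y : Fin M → ℝ} (hx : x ∈ S) (hxr : ∀ j, r j = 0 → x j = 0)
    (hmin : ∀ y ∈ S, (∀ j, r j = 0 → y j = 0) → klSum x r ≤ klSum y r)
    (hy : y ∈ S) (hyr : ∀ j, r j = 0 → y j = 0) {t : ℝ} (ht : 0 < t) (ht1 : t < 1) :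
    klSum y (fun j => (1 - t) * x j + t * y j) ≤ klSum y r - klSum x r := by
  set z : Fin M → ℝ := fun j => (1 - t) * x j + t * y j with hz
  have hzS : z ∈ S := by
    have := hconv hx hy (by linarith : (0:ℝ) ≤ 1 - t) ht.le (by ring)
    exact this
  have hzr : ∀ j, r j = 0 → z j = 0 := fun j hj => by simp [hz, hxr j hj, hyr j hj]
  have hid : (1 - t) * klSum x r + t * klSum y r =
      klSum z r + ((1 - t) * klSum x z + t * klSum y z) := by
    simp only [klSum, Finset.mul_sum, ← Finset.sum_add_distrib]
    exact Finset.sum_congr rfl fun j _ =>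
      klTerm_convex_identity (hS x hx j) (hS y hy j) (hxr j) (hyr j) ht ht1
  have hxz : 0 ≤ klSum x z := by
    refine klSum_nonneg (hS x hx) (hS z hzS) fun j hj => ?_
    have h1 : 0 ≤ (1 - t) * x j := mul_nonneg (by linarith) (hS x hx j)
    have h2 : 0 ≤ t * y j := mul_nonneg ht.le (hS y hy j)
    have : (1 - t) * x j = 0 := by simp only [hz] at hj; linarith
    exact (mul_eq_zero.1 this).resolve_left (by linarith)
  -- Minimality at `z` cancels the `r`-terms; dropping `(1 - t) KL(x, z) ≥ 0` leaves a factor `t` to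
  -- divide out.
  have h1 := hmin z hzS hzr
  have h2 : 0 ≤ (1 - t) * klSum x z := mul_nonneg (by linarith) hxz
  have h3 : t * klSum y z ≤ t * (klSum y r - klSum x r) := by linarith
  exact le_of_mul_le_mul_left h3 ht

theorem existsUnique_isKLProj {S : Set (Fin M → ℝ)} (hS : ∀ x ∈ S, ∀ j, 0 ≤ x j)
    (hconv : Convex ℝ S) (hcomp : IsCompact S) {r : Fin M → ℝ}
    (hr : ∀ j, 0 ≤ r j) (hne : ∃ x ∈ S, ∀ j, r j = 0 → x j = 0) :
    ∃! x, IsKLProj S r x := by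
  have hclosed : IsClosed {x : Fin M → ℝ | ∀ j, r j = 0 → x j = 0} := by
    simp only [Set.ofPred_forall]
    exact isClosed_iInter fun j => isClosed_iInter fun _ =>
      isClosed_eq (continuous_apply j) continuous_const
  obtain ⟨x, ⟨hx, hxr⟩, hmin⟩ := (hcomp.inter_right hclosed).exists_isMinOn
    (hne.imp fun x hx => hx) (continuous_klSum_left r).continuousOn
  have hmin' : ∀ y ∈ S, (∀ j, r j = 0 → y j = 0) → klSum x r ≤ klSum y r :=
    fun y hy hyr => hmin ⟨hy, hyr⟩
  refine ⟨x, (isKLProj_iff hS hr hne).2 ⟨hx, hxr, hmin'⟩, fun y hy => ?_⟩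
  obtain ⟨hyS, hyr, hymin⟩ := (isKLProj_iff hS hr hne).1 hy
  -- For two minimizers the bound is nonpositive, so `y` equals the midpoint of `x` and `y`.
  have h1 := klSum_segment_le hS hconv hx hxr hmin' hyS hyr (t := 1 / 2) (by norm_num)
    (by norm_num)
  have h2 := hymin x hx hxr
  have hdom : ∀ j, (1 - 1 / 2 : ℝ) * x j + 1 / 2 * y j = 0 → y j = 0 := fun j hj => by
    linarith [hS x hx j, hS y hyS j]
  have hz0 : ∀ j, 0 ≤ (1 - 1 / 2 : ℝ) * x j + 1 / 2 * y j := fun j => by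
    linarith [hS x hx j, hS y hyS j]
  funext j
  have h3 := (sq_sqrt_sub_sqrt_le_klTerm (hS y hyS j) (hz0 j) (hdom j)).trans
    ((klTerm_le_klSum (hS y hyS) hz0 hdom j).trans (h1.trans (sub_nonpos.2 h2)))
  have h4 : √(y j) = √((1 - 1 / 2 : ℝ) * x j + 1 / 2 * y j) :=
    sub_eq_zero.1 (pow_eq_zero_iff (two_ne_zero) |>.1 (le_antisymm h3 (sq_nonneg _)))
  rw [Real.sqrt_inj (hS y hyS j) (hz0 j)] at h4
  linarith

/-- The KL projection onto a convex set has maximal support. -/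
theorem dominated_of_minimizer {S : Set (Fin M → ℝ)} (hS : ∀ x ∈ S, ∀ j, 0 ≤ x j)
    (hconv : Convex ℝ S) {r x y : Fin M → ℝ} (hx : x ∈ S)
    (hxr : ∀ j, r j = 0 → x j = 0)
    (hmin : ∀ y ∈ S, (∀ j, r j = 0 → y j = 0) → klSum x r ≤ klSum y r)
    (hy : y ∈ S) (hyr : ∀ j, r j = 0 → y j = 0) (j : Fin M) (hj : x j = 0) : y j = 0 := by
  by_contra hne
  have hpos : 0 < y j := (hS y hy j).lt_of_ne (Ne.symm hne)
  set K := klSum y r - klSum x r with hK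
  have hK0 : 0 ≤ K := sub_nonneg.2 (hmin y hy hyr)
  -- With `x j = 0` and `t = exp (-c)`, the `j`-th term of `KL(y, z_t)` is `y j * c - y j + t * y j
  -- = K + (1 + t) * y j`, exceeding the bound `K`.
  set c := K / y j + 2 with hc
  have hc0 : 0 < c := by positivity
  set t := Real.exp (-c) with ht
  have ht0 : 0 < t := Real.exp_pos _
  have ht1 : t < 1 := Real.exp_zero ▸ Real.exp_lt_exp.2 (by linarith)
  have h1 := klSum_segment_le hS hconv hx hxr hmin hy hyr ht0 ht1
  have hz : ∀ i, 0 ≤ (1 - t) * x i := fun i => mul_nonneg (by linarith) (hS x hx i)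
  have hz' : ∀ i, 0 ≤ t * y i := fun i => mul_nonneg ht0.le (hS y hy i)
  have h2 := (klTerm_le_klSum (p := y) (r := fun j => (1 - t) * x j + t * y j) (hS y hy)
    (fun i => add_nonneg (hz i) (hz' i)) (fun i hi => by
      have : t * y i = 0 := by linarith [hz i, hz' i]
      exact (mul_eq_zero.1 this).resolve_left ht0.ne') j).trans h1
  have h3 : Real.log (y j / (t * y j)) = c := by
    rw [div_mul_cancel_right₀ hne, Real.log_inv, ht, Real.log_exp, neg_neg]
  simp only [klTerm, hj, mul_zero, zero_add, h3] at h2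
  have h4 : y j * c = K + 2 * y j := by
    rw [hc]
    field_simp
  nlinarith [mul_pos ht0 hpos]

/-! ### Affine subsets of the simplex and the Pythagorean identity -/

theorem hasDerivAt_klTerm {a r : ℝ} (ha : 0 < a) (hr : 0 < r) :
    HasDerivAt (fun a => klTerm a r) (Real.log (a / r)) a := by
  unfold klTerm
  have h1 : HasDerivAt (fun a : ℝ => a / r) (1 / r) a := (hasDerivAt_id a).div_const r
  have h2 : HasDerivAt (fun a => a * Real.log (a / r) - a)
      (1 * Real.log (a / r) + a * (1 / r / (a / r)) - 1) a :=
    ((hasDerivAt_id a).mul (h1.log (div_pos ha hr).ne')).sub (hasDerivAt_id a)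
  have h3 : a * (1 / r / (a / r)) = 1 := by field_simp
  rw [h3, one_mul, add_sub_cancel_right] at h2
  exact h2.add_const r

theorem convex_affineSubset {m : ℕ} (A : Matrix (Fin m) (Fin M) ℝ) (b : Fin m → ℝ) :
    Convex ℝ (affineSubset A b) := by
  rintro x ⟨hx, hxA⟩ y ⟨hy, hyA⟩ s t hs ht hst
  refine ⟨convex_stdSimplex ℝ (Fin M) hx hy hs ht hst, ?_⟩
  rw [Matrix.mulVec_add, Matrix.mulVec_smul, Matrix.mulVec_smul, hxA, hyA, ← add_smul, hst,
    one_smul]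

theorem isClosed_affineSubset {m : ℕ} (A : Matrix (Fin m) (Fin M) ℝ) (b : Fin m → ℝ) :
    IsClosed (affineSubset A b) :=
  (isClosed_stdSimplex ℝ (Fin M)).inter
    (isClosed_eq (Continuous.matrix_mulVec continuous_const continuous_id) continuous_const)

theorem isCompact_affineSubset {m : ℕ} (A : Matrix (Fin m) (Fin M) ℝ) (b : Fin m → ℝ) :
    IsCompact (affineSubset A b) :=
  (isCompact_stdSimplex ℝ (Fin M)).of_isClosed_subset (isClosed_affineSubset A b) fun _ h => h.1

theorem affineSubset_nonneg {m : ℕ} {A : Matrix (Fin m) (Fin M) ℝ} {b : Fin m → ℝ}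
    (x : Fin M → ℝ) (hx : x ∈ affineSubset A b) (j : Fin M) : 0 ≤ x j := hx.1.1 j

/-- The Pythagorean identity for KL projections onto affine subsets of the simplex. -/
theorem pythagoras_affineSubset {m : ℕ} {A : Matrix (Fin m) (Fin M) ℝ} {b : Fin m → ℝ}
    {r x y : Fin M → ℝ} (hr : ∀ j, 0 ≤ r j) (hx : x ∈ affineSubset A b)
    (hxr : ∀ j, r j = 0 → x j = 0)
    (hmin : ∀ y ∈ affineSubset A b, (∀ j, r j = 0 → y j = 0) → klSum x r ≤ klSum y r)
    (hy : y ∈ affineSubset A b) (hyr : ∀ j, r j = 0 → y j = 0) :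
    klSum y r - klSum y x = klSum x r := by
  have hyx : ∀ j, x j = 0 → y j = 0 :=
    dominated_of_minimizer affineSubset_nonneg (convex_affineSubset A b) hx hxr hmin hy hyr
  have hder : HasDerivAt (fun t : ℝ => klSum (fun j => x j + t * (y j - x j)) r)
      (∑ j, (y j - x j) * Real.log (x j / r j)) 0 := by
    unfold klSum
    refine HasDerivAt.fun_sum fun j _ => ?_
    by_cases hj : x j = 0
    · simpa [hj, hyx j hj] using hasDerivAt_const (0 : ℝ) (klTerm 0 (r j))
    have hxj : 0 < x j := (affineSubset_nonneg x hx j).lt_of_ne (Ne.symm hj)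
    have hrj : 0 < r j := (hr j).lt_of_ne fun h => hj (hxr j h.symm)
    have h1 : HasDerivAt (fun t : ℝ => x j + t * (y j - x j)) (y j - x j) 0 := by
      simpa using ((hasDerivAt_id (0 : ℝ)).mul_const (y j - x j)).const_add (x j)
    have h2 := hasDerivAt_klTerm hxj hrj
    have h3 : x j = x j + 0 * (y j - x j) := by ring
    rw [h3] at h2
    have h4 := h2.comp (0 : ℝ) h1
    simpa [mul_comm, Function.comp_def] using h4
  have hloc : IsLocalMin (fun t : ℝ => klSum (fun j => x j + t * (y j - x j)) r) 0 := by
    -- Maximal support lets the line through `x` and `y` stay nonnegative also for small `t < 0`, so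
    -- the first-order condition is an equality.
    have hnn : ∀ᶠ t : ℝ in 𝓝 0, ∀ j, 0 ≤ x j + t * (y j - x j) := by
      refine eventually_all.2 fun j => ?_
      by_cases hj : x j = 0
      · exact Eventually.of_forall fun t => by simp [hj, hyx j hj]
      have hxj : 0 < x j := (affineSubset_nonneg x hx j).lt_of_ne (Ne.symm hj)
      have hcont : ContinuousAt (fun t : ℝ => x j + t * (y j - x j)) 0 := by fun_prop
      exact (hcont.eventually (lt_mem_nhds (by simpa using hxj))).mono fun t ht => le_of_lt ht
    filter_upwards [hnn] with t ht
    have hmem : (fun j => x j + t * (y j - x j)) ∈ affineSubset A b := by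
      refine ⟨⟨ht, ?_⟩, ?_⟩
      · rw [Finset.sum_add_distrib, ← Finset.mul_sum, Finset.sum_sub_distrib, hx.1.2, hy.1.2]
        ring
      · have : (fun j => x j + t * (y j - x j)) = x + t • (y - x) := rfl
        rw [this, Matrix.mulVec_add, Matrix.mulVec_smul, Matrix.mulVec_sub, hx.2, hy.2]
        simp
    simpa using hmin _ hmem fun j hj => by simp [hxr j hj, hyr j hj]
  have hzero := hloc.hasDerivAt_eq_zero hder
  have hsum : klSum y r - klSum y x - klSum x r =
      (∑ j, (y j - x j) * Real.log (x j / r j)) + (∑ j, x j - ∑ j, x j) := by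
    simp only [klSum, ← Finset.sum_sub_distrib, ← Finset.sum_add_distrib]
    refine Finset.sum_congr rfl fun j _ => ?_
    unfold klTerm
    rw [mul_log_div_chain (hyx j) (hyr j)]
    ring
  rw [hzero] at hsum
  linarith

/-! ### Normalized systems and the GIS step -/

theorem mulVec_eq_sum {ι : Type*} (A : Matrix ι (Fin M) ℝ) (p : Fin M → ℝ) (i : ι) :
    A.mulVec p i = ∑ j, A i j * p j := rfl

/-- A nonnegative system `A x = b` whose column sums and right-hand side sum are all `1`. -/
structure IsNormalized {ι : Type} [Fintype ι] (A : Matrix ι (Fin M) ℝ) (b : ι → ℝ) : Prop where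
  matrix_nonneg : ∀ i j, 0 ≤ A i j
  colSum : ∀ j, ∑ i, A i j = 1
  rhs_nonneg : ∀ i, 0 ≤ b i
  rhsSum : ∑ i, b i = 1

namespace IsNormalized

variable {ι : Type} [Fintype ι] {A : Matrix ι (Fin M) ℝ} {b : ι → ℝ} (hAb : IsNormalized A b)
  {p x : Fin M → ℝ}

include hAb

theorem mulVec_nonneg (hp : ∀ j, 0 ≤ p j) (i : ι) : 0 ≤ A.mulVec p i := by
  rw [mulVec_eq_sum]
  exact Finset.sum_nonneg fun j _ => mul_nonneg (hAb.matrix_nonneg i j) (hp j)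

theorem sum_mulVec (p : Fin M → ℝ) : ∑ i, A.mulVec p i = ∑ j, p j := by
  simp only [Matrix.mulVec, dotProduct]
  rw [Finset.sum_comm]
  simp [← Finset.sum_mul, hAb.colSum]

theorem mul_eq_zero_of_mulVec (hp : ∀ j, 0 ≤ p j) {i : ι} (hi : A.mulVec p i = 0) (j : Fin M) :
    A i j * p j = 0 := by
  rw [mulVec_eq_sum] at hi
  exact (Finset.sum_eq_zero_iff_of_nonneg fun j _ => mul_nonneg (hAb.matrix_nonneg i j) (hp j)).1 hi j
    (Finset.mem_univ j)

/-- A row with `(A p)_i = 0` vanishes on the support of `p`, hence on that of `x`. -/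
theorem rhs_eq_zero (hp : ∀ j, 0 ≤ p j) (hxA : A.mulVec x = b) (hxp : ∀ j, p j = 0 → x j = 0)
    (i : ι) (hi : A.mulVec p i = 0) : b i = 0 := by
  rw [← hxA, mulVec_eq_sum]
  refine Finset.sum_eq_zero fun j _ => ?_
  rcases mul_eq_zero.1 (hAb.mul_eq_zero_of_mulVec hp hi j) with h | h
  · simp [h]
  · simp [hxp j h]

theorem ratio_nonneg (hp : ∀ j, 0 ≤ p j) (i : ι) : 0 ≤ b i / A.mulVec p i :=
  div_nonneg (hAb.rhs_nonneg i) (hAb.mulVec_nonneg hp i)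

theorem gisStep_nonneg (hp : ∀ j, 0 ≤ p j) (j : Fin M) : 0 ≤ gisStep A b p j :=
  mul_nonneg (hp j) (Finset.prod_nonneg fun i _ => Real.rpow_nonneg (hAb.ratio_nonneg hp i) _)

/-- Weighted AM-GM in each column, the weights `A i j` summing to `1`. -/
theorem sum_gisStep_le (hp : ∀ j, 0 ≤ p j) : ∑ j, gisStep A b p j ≤ 1 := by
  have h1 : ∀ j, gisStep A b p j ≤ ∑ i, A i j * p j * (b i / A.mulVec p i) := fun j => by
    have h := Real.geom_mean_le_arith_mean_weighted Finset.univ (fun i => A i j)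
      (fun i => b i / A.mulVec p i) (fun i _ => hAb.matrix_nonneg i j) (hAb.colSum j)
      (fun i _ => hAb.ratio_nonneg hp i)
    refine (mul_le_mul_of_nonneg_left h (hp j)).trans (le_of_eq ?_)
    rw [Finset.mul_sum]
    exact Finset.sum_congr rfl fun i _ => by ring
  calc ∑ j, gisStep A b p j ≤ ∑ j, ∑ i, A i j * p j * (b i / A.mulVec p i) :=
        Finset.sum_le_sum fun j _ => h1 j
    _ = ∑ i, A.mulVec p i * (b i / A.mulVec p i) := by
        rw [Finset.sum_comm]
        exact Finset.sum_congr rfl fun i _ => (Finset.sum_mul _ _ _).symm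
    _ ≤ ∑ i, b i := Finset.sum_le_sum fun i _ => by
        -- Here the ratio is `b i / 0 = 0`, so only an inequality remains.
        by_cases h : A.mulVec p i = 0
        · simpa [h] using hAb.rhs_nonneg i
        · exact (mul_div_cancel₀ _ h).le
    _ = 1 := hAb.rhsSum

/-- On the support of a solution, every factor with nonzero exponent has a positive base, so
logarithms of the product may be taken there. -/
theorem ratio_pos (hp : ∀ j, 0 ≤ p j) (hx : ∀ j, 0 ≤ x j) (hxA : A.mulVec x = b)
    (hxp : ∀ j, p j = 0 → x j = 0) {j : Fin M} (hj : x j ≠ 0) {i : ι} (hij : A i j ≠ 0) :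
    0 < b i / A.mulVec p i := by
  have hb : b i ≠ 0 := fun h => by
    rw [← hxA] at h
    exact mul_ne_zero hij hj (hAb.mul_eq_zero_of_mulVec hx h j)
  exact (hAb.ratio_nonneg hp i).lt_of_ne
    (div_ne_zero hb fun h => hb (hAb.rhs_eq_zero hp hxA hxp i h)).symm

theorem factor_pos (hp : ∀ j, 0 ≤ p j) (hx : ∀ j, 0 ≤ x j) (hxA : A.mulVec x = b)
    (hxp : ∀ j, p j = 0 → x j = 0) {j : Fin M} (hj : x j ≠ 0) (i : ι) :
    0 < (b i / A.mulVec p i) ^ A i j := by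
  by_cases hij : A i j = 0
  · simp [hij]
  · exact Real.rpow_pos_of_pos (hAb.ratio_pos hp hx hxA hxp hj hij) _

theorem dominated_gisStep (hp : ∀ j, 0 ≤ p j) (hx : ∀ j, 0 ≤ x j) (hxA : A.mulVec x = b)
    (hxp : ∀ j, p j = 0 → x j = 0) (j : Fin M) (hj : gisStep A b p j = 0) : x j = 0 := by
  by_contra hne
  have h1 : p j ≠ 0 := fun h => hne (hxp j h)
  exact mul_ne_zero h1
    (Finset.prod_pos fun i _ => hAb.factor_pos hp hx hxA hxp hne i).ne' hj

/-- The decrease of the divergence in one GIS step is the same for all solutions `x`. -/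
theorem klSum_sub_klSum_gisStep (hp : ∀ j, 0 ≤ p j) (hx : ∀ j, 0 ≤ x j) (hxA : A.mulVec x = b)
    (hxp : ∀ j, p j = 0 → x j = 0) :
    klSum x p - klSum x (gisStep A b p) =
      klSum b (A.mulVec p) + (1 - ∑ j, gisStep A b p j) := by
  have h1 : ∀ j, klTerm (x j) (p j) - klTerm (x j) (gisStep A b p j) =
      ∑ i, A i j * x j * Real.log (b i / A.mulVec p i) + (p j - gisStep A b p j) := fun j => by
    by_cases hj : x j = 0
    · simp [klTerm, hj]
    have hpj : p j ≠ 0 := fun h => hj (hxp j h)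
    have hpos := fun i => hAb.factor_pos hp hx hxA hxp hj i
    have hlog : Real.log (gisStep A b p j) =
        Real.log (p j) + ∑ i, A i j * Real.log (b i / A.mulVec p i) := by
      unfold gisStep
      rw [Real.log_mul hpj (Finset.prod_pos fun i _ => hpos i).ne',
        Real.log_prod fun i _ => (hpos i).ne']
      congr 1
      refine Finset.sum_congr rfl fun i _ => ?_
      by_cases hij : A i j = 0
      · simp [hij]
      · exact Real.log_rpow (hAb.ratio_pos hp hx hxA hxp hj hij) _
    have hg : gisStep A b p j ≠ 0 := fun h => hj (hAb.dominated_gisStep hp hx hxA hxp j h)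
    unfold klTerm
    rw [Real.log_div hj hpj, Real.log_div hj hg, hlog]
    have : ∑ i, A i j * x j * Real.log (b i / A.mulVec p i) =
        x j * ∑ i, A i j * Real.log (b i / A.mulVec p i) := by
      rw [Finset.mul_sum]
      exact Finset.sum_congr rfl fun i _ => by ring
    rw [this]
    ring
  have h2 : ∑ j, ∑ i, A i j * x j * Real.log (b i / A.mulVec p i) =
      ∑ i, b i * Real.log (b i / A.mulVec p i) := by
    rw [Finset.sum_comm]
    refine Finset.sum_congr rfl fun i _ => ?_
    rw [← Finset.sum_mul]
    congr 1
    exact congrFun hxA i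
  have h3 : klSum b (A.mulVec p) =
      ∑ i, b i * Real.log (b i / A.mulVec p i) - 1 + ∑ j, p j := by
    unfold klSum klTerm
    rw [Finset.sum_add_distrib, Finset.sum_sub_distrib, hAb.rhsSum, hAb.sum_mulVec]
  rw [h3, ← h2]
  unfold klSum
  rw [← Finset.sum_sub_distrib, Finset.sum_congr rfl fun j _ => h1 j, Finset.sum_add_distrib,
    Finset.sum_sub_distrib]
  ring

/-- At a solution of the system, a GIS step is continuous and fixes the solution. -/
theorem tendsto_gisStep {α : Type*} {l : Filter α} {f : α → Fin M → ℝ}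
    (hx : ∀ j, 0 ≤ x j) (hxA : A.mulVec x = b) (hf : Tendsto f l (𝓝 x)) :
    Tendsto (fun k => gisStep A b (f k)) l (𝓝 x) := by
  have hAf : Tendsto (fun k => A.mulVec (f k)) l (𝓝 b) := by
    rw [← hxA]
    exact ((Continuous.matrix_mulVec continuous_const continuous_id).tendsto x).comp hf
  refine tendsto_pi_nhds.2 fun j => ?_
  -- A zero right-hand side met by column `j` annihilates that coordinate of both the step and the
  -- solution. Otherwise each nontrivial factor has `b i ≠ 0` and tends to `1`.
  by_cases h : ∃ i, b i = 0 ∧ A i j ≠ 0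
  · obtain ⟨i, hbi, hij⟩ := h
    have hxj : x j = 0 :=
      (mul_eq_zero.1 (hAb.mul_eq_zero_of_mulVec hx (by rw [hxA, hbi]) j)).resolve_left hij
    have hz : ∀ k, gisStep A b (f k) j = 0 := fun k =>
      mul_eq_zero_of_right _ (Finset.prod_eq_zero (Finset.mem_univ i)
        (by rw [hbi, zero_div, Real.zero_rpow hij]))
    simp only [hz, hxj, tendsto_const_nhds]
  · push Not at h
    have hprod : Tendsto (fun k => ∏ i, (b i / A.mulVec (f k) i) ^ A i j) l (𝓝 1) := by
      rw [← Finset.prod_const_one (ι := ι) (s := Finset.univ)]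
      refine tendsto_finsetProd _ fun i _ => ?_
      by_cases hij : A i j = 0
      · simpa [hij] using tendsto_const_nhds
      have hbi : b i ≠ 0 := fun hb => hij (h i hb)
      have h1 : Tendsto (fun k => b i / A.mulVec (f k) i) l (𝓝 (b i / b i)) :=
        tendsto_const_nhds.div (tendsto_pi_nhds.1 hAf i) hbi
      rw [div_self hbi] at h1
      simpa using h1.rpow_const (p := A i j) (Or.inl one_ne_zero)
    simpa [gisStep] using (tendsto_pi_nhds.1 hf j).mul hprod

end IsNormalized

/-! ### Correctness of the normalization -/

section

variable {m : ℕ} {A : Matrix (Fin m) (Fin M) ℝ} {b : Fin m → ℝ} {ξ ξ' : ℝ}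

theorem IsAdmissible.scale_nonneg (h : IsAdmissible A b ξ ξ') : 0 ≤ ξ' :=
  (Finset.sum_nonneg fun i _ => sub_nonneg.2 (h.shift_le_rhs i)).trans h.rhsSum_le_scale

/-- Deleted rows contribute zero by `hf`, so the sum may run over all original rows plus the
appended one. -/
theorem sum_normRow (f : Fin m → ℝ) (c : ℝ)
    (hf : ∀ i, (∀ j, scaledMatrix A ξ ξ' i j = 0) ∧ scaledRhs b ξ ξ' i = 0 → f i = 0)
    (g : NormRow A b ξ ξ' → ℝ) (hg : ∀ i, g (some i) = f i.1) (hc : g none = c) :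
    ∑ r, g r = c + ∑ i, f i := by
  classical
  -- The `Fintype` instance on `NormRow` comes from `Fintype.ofFinite`, so the two `univ`s are
  -- matched by extensionality.
  have h1 : ∑ r, g r = g none + ∑ i, g (some i) := by
    rw [← Fintype.sum_option]
    exact Finset.sum_congr (by ext; simp) fun _ _ => rfl
  rw [h1, hc, Finset.sum_congr rfl fun i _ => hg i]
  congr 1
  have h2 := Finset.sum_subtype_of_mem f (s := Finset.univ.filter
    fun i => ¬ ((∀ j, scaledMatrix A ξ ξ' i j = 0) ∧ scaledRhs b ξ ξ' i = 0))
    (p := fun i => ¬ ((∀ j, scaledMatrix A ξ ξ' i j = 0) ∧ scaledRhs b ξ ξ' i = 0))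
    (by simp)
  rw [← Finset.sum_filter_of_ne (s := Finset.univ)
    (p := fun i => ¬ ((∀ j, scaledMatrix A ξ ξ' i j = 0) ∧ scaledRhs b ξ ξ' i = 0))
    (fun i _ hi h => hi (hf i h)), ← h2]
  exact Finset.sum_congr (by ext i; simpa using fun h h' => i.2 ⟨h, h'⟩) fun _ _ => rfl

theorem IsAdmissible.isNormalized (h : IsAdmissible A b ξ ξ') :
    IsNormalized (normMatrix A b ξ ξ') (normRhs A b ξ ξ') := by
  have hs : 0 ≤ 1 / ξ' := one_div_nonneg.2 h.scale_nonneg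
  -- For `ξ' = 0` the product is `0`.
  have hle : 1 / ξ' * ξ' ≤ 1 := by
    by_cases h0 : ξ' = 0
    · simp [h0]
    · exact (one_div_mul_cancel h0).le
  have hA : ∀ i j, 0 ≤ scaledMatrix A ξ ξ' i j := fun i j =>
    mul_nonneg hs (sub_nonneg.2 (h.shift_le_matrix i j))
  have hb : ∀ i, 0 ≤ scaledRhs b ξ ξ' i := fun i =>
    mul_nonneg hs (sub_nonneg.2 (h.shift_le_rhs i))
  refine ⟨fun r j => ?_, fun j => ?_, fun r => ?_, ?_⟩
  · rcases r with _ | i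
    · have h1 : ∑ i, scaledMatrix A ξ ξ' i j = 1 / ξ' * ∑ i, (A i j - ξ) :=
        (Finset.mul_sum _ _ _).symm
      have h2 := mul_le_mul_of_nonneg_left (h.colSum_le_scale j) hs
      exact sub_nonneg.2 (h1.le.trans (h2.trans hle))
    · exact hA i.1 j
  · rw [sum_normRow (fun i => scaledMatrix A ξ ξ' i j) _ (fun i hi => hi.1 j) _ (fun _ => rfl) rfl]
    simp [normMatrix]
  · rcases r with _ | i
    · have h1 : ∑ i, scaledRhs b ξ ξ' i = 1 / ξ' * ∑ i, (b i - ξ) :=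
        (Finset.mul_sum _ _ _).symm
      have h2 := mul_le_mul_of_nonneg_left h.rhsSum_le_scale hs
      exact sub_nonneg.2 (h1.le.trans (h2.trans hle))
    · exact hb i.1
  · rw [sum_normRow (fun i => scaledRhs b ξ ξ' i) _ (fun i hi => hi.2) _ (fun _ => rfl) rfl]
    simp [normRhs]

theorem scaledMatrix_mulVec {x : Fin M → ℝ} (hx : ∑ j, x j = 1) (i : Fin m) :
    (scaledMatrix A ξ ξ').mulVec x i = 1 / ξ' * (A.mulVec x i - ξ) := by
  simp only [scaledMatrix, Matrix.mulVec, dotProduct, Matrix.of_apply]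
  have : ∑ j, 1 / ξ' * (A i j - ξ) * x j = 1 / ξ' * (∑ j, A i j * x j - ξ * ∑ j, x j) := by
    rw [Finset.mul_sum, ← Finset.sum_sub_distrib, Finset.mul_sum]
    exact Finset.sum_congr rfl fun j _ => by ring
  rw [this, hx, mul_one]

theorem normMatrix_mulVec_none (x : Fin M → ℝ) :
    (normMatrix A b ξ ξ').mulVec x none =
      ∑ j, x j - ∑ i, (scaledMatrix A ξ ξ').mulVec x i := by
  simp only [normMatrix, Matrix.mulVec, dotProduct, Matrix.of_apply]
  rw [Finset.sum_comm, ← Finset.sum_sub_distrib]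
  refine Finset.sum_congr rfl fun j _ => ?_
  rw [sub_mul, one_mul, Finset.sum_mul]

/-- The normalized system has the same nonnegative solutions as the original one has in the
simplex. -/
theorem IsAdmissible.mem_affineSubset_iff (h : IsAdmissible A b ξ ξ') {x : Fin M → ℝ} :
    x ∈ affineSubset A b ↔
      (∀ j, 0 ≤ x j) ∧ (normMatrix A b ξ ξ').mulVec x = normRhs A b ξ ξ' := by
  constructor
  · rintro ⟨hx, hxA⟩
    have hrow : ∀ i, (scaledMatrix A ξ ξ').mulVec x i = scaledRhs b ξ ξ' i := fun i => by
      rw [scaledMatrix_mulVec hx.2, hxA]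
      rfl
    refine ⟨hx.1, funext fun r => ?_⟩
    rcases r with _ | i
    · rw [normMatrix_mulVec_none, hx.2, Finset.sum_congr rfl fun i _ => hrow i]
      rfl
    · exact hrow i.1
  · rintro ⟨hx, hxA⟩
    -- Unit column sums make the simplex constraint a consequence of the normalized system.
    have hsum : ∑ j, x j = 1 := by
      rw [← h.isNormalized.sum_mulVec, hxA, h.isNormalized.rhsSum]
    refine ⟨⟨hx, hsum⟩, funext fun i => ?_⟩
    -- A zero scale forces every entry of `A` and `b` to equal `ξ`, and each equation reads `ξ * ∑ x
    -- = ξ`.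
    by_cases h0 : ξ' = 0
    · have hb : b i - ξ = 0 :=
        (Finset.sum_eq_zero_iff_of_nonneg fun i _ => sub_nonneg.2 (h.shift_le_rhs i)).1
          (le_antisymm (h0 ▸ h.rhsSum_le_scale)
            (Finset.sum_nonneg fun i _ => sub_nonneg.2 (h.shift_le_rhs i))) i (Finset.mem_univ i)
      have hA : ∀ j, A i j = ξ := fun j => sub_eq_zero.1 <|
        (Finset.sum_eq_zero_iff_of_nonneg fun i _ => sub_nonneg.2 (h.shift_le_matrix i j)).1
          (le_antisymm (h0 ▸ h.colSum_le_scale j)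
            (Finset.sum_nonneg fun i _ => sub_nonneg.2 (h.shift_le_matrix i j))) i
              (Finset.mem_univ i)
      simp only [Matrix.mulVec, dotProduct, hA, ← Finset.mul_sum, hsum]
      linarith
    · have hs : 1 / ξ' ≠ 0 := one_div_ne_zero h0
      have hrow : (scaledMatrix A ξ ξ').mulVec x i = scaledRhs b ξ ξ' i := by
        by_cases hi : (∀ j, scaledMatrix A ξ ξ' i j = 0) ∧ scaledRhs b ξ ξ' i = 0
        · rw [hi.2, mulVec_eq_sum]
          exact Finset.sum_eq_zero fun j _ => by rw [hi.1 j, zero_mul]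
        · exact congrFun hxA (some ⟨i, hi⟩)
      rw [scaledMatrix_mulVec hsum] at hrow
      have := mul_left_cancel₀ hs hrow
      linarith

end

/-! ### Convergence principle for equal gains -/

/-- Convergence of cyclic iterations which decrease the divergence from all points of the
intersection of the sets `S i` by the same amounts `Δ k`. -/
theorem exists_tendsto_of_equal_gain {n : ℕ} [NeZero n] {S : Fin n → Set (Fin M → ℝ)}
    {p : ℕ → Fin M → ℝ} {Δ : ℕ → ℝ} {B : ℝ} (hp : ∀ k j, 0 ≤ p k j) (hB : ∀ k j, p k j ≤ B)
    (hne : (⋂ i, S i).Nonempty) (hS : ∀ x ∈ ⋂ i, S i, ∀ j, 0 ≤ x j)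
    (hdom : ∀ x ∈ ⋂ i, S i, ∀ k j, p k j = 0 → x j = 0) (hΔ0 : ∀ k, 0 ≤ Δ k)
    (hΔ : ∀ x ∈ ⋂ i, S i, ∀ k, klSum x (p k) - klSum x (p (k + 1)) = Δ k)
    (hlim : ∀ (i : Fin n) (F : Filter ℕ) [F.NeBot] (y : Fin M → ℝ),
      (∀ᶠ k in F, Fin.ofNat n k = i) → Tendsto Δ F (𝓝 0) → Tendsto p F (𝓝 y) →
        y ∈ S i ∧ Tendsto (fun k => p (k + 1)) F (𝓝 y)) :
    ∃ y ∈ ⋂ i, S i, Tendsto p atTop (𝓝 y) ∧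
      ∀ x ∈ ⋂ i, S i, klSum y (p 0) ≤ klSum x (p 0) := by
  have hnn : ∀ x ∈ ⋂ i, S i, ∀ k, 0 ≤ klSum x (p k) := fun x hx k =>
    klSum_nonneg (hS x hx) (hp k) (hdom x hx k)
  have hgain : ∀ x ∈ ⋂ i, S i, ∀ k, klSum x (p k) = klSum x (p 0) - ∑ l ∈ Finset.range k, Δ l := by
    intro x hx k
    induction k with
    | zero => simp
    | succ k ih =>
      rw [Finset.sum_range_succ]
      linarith [hΔ x hx k]
  have hΔlim : Tendsto Δ atTop (𝓝 0) := by
    obtain ⟨x, hx⟩ := hne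
    refine (summable_of_sum_range_le (c := klSum x (p 0)) hΔ0 fun k => ?_).tendsto_atTop_zero
    linarith [hnn x hx k, hgain x hx k]
  -- An ultrafilter replaces subsequences: along it the bounded iterates converge and the residue of
  -- `k` mod `n` is eventually constant, as it is along each shift.
  let U : Ultrafilter ℕ := Ultrafilter.of atTop
  have hU : (U : Filter ℕ) ≤ atTop := Ultrafilter.of_le _
  have hcompact : IsCompact (Set.Icc (fun _ => 0 : Fin M → ℝ) fun _ => B) := isCompact_Icc
  obtain ⟨y, -, hy⟩ := hcompact.ultrafilter_le_nhds' (U.map p)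
    (Ultrafilter.mem_map.2 (Filter.univ_mem' fun k => ⟨fun j => hp k j, fun j => hB k j⟩))
  have hyU : Tendsto p U (𝓝 y) := hy
  have hresidue : ∀ V : Ultrafilter ℕ, ∃ i : Fin n, ∀ᶠ k in (V : Filter ℕ), Fin.ofNat n k = i := by
    intro V
    obtain ⟨i, -, hi⟩ := isCompact_univ.ultrafilter_le_nhds' (V.map (Fin.ofNat n)) univ_mem
    refine ⟨i, ?_⟩
    rw [nhds_discrete] at hi
    exact hi (mem_pure.2 rfl : {i} ∈ pure i)
  have hshift : ∀ s, Tendsto (fun k => k + s) U atTop := fun s =>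
    (tendsto_add_atTop_nat s).mono_left hU
  have hys : ∀ s, Tendsto p (U.map fun k => k + s : Ultrafilter ℕ) (𝓝 y) := by
    intro s
    induction s with
    | zero => simpa using hyU
    | succ s ih =>
      obtain ⟨i, hi⟩ := hresidue (U.map fun k => k + s)
      exact (hlim i _ y hi (hΔlim.mono_left (hshift s)) ih).2
  have hyS : y ∈ ⋂ i, S i := by
    refine Set.mem_iInter.2 fun i => ?_
    obtain ⟨r, hr⟩ := hresidue U
    -- Shifting by `i + (n - r)` moves residue `r` to residue `i` without truncated subtraction, so
    -- every block is tested at the same limit `y`.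
    have hi : ∀ᶠ k in ((U.map fun k => k + (i.val + (n - r.val)) : Ultrafilter ℕ) : Filter ℕ),
        Fin.ofNat n k = i := by
      refine Filter.eventually_map.2 (hr.mono fun k hk => Fin.ext ?_)
      have hk' : k % n = r.val := congrArg Fin.val hk
      have hrn := r.isLt
      change (k + (i.val + (n - r.val))) % n = i.val
      have : k + (i.val + (n - r.val)) = i.val + n * (k / n + 1) := by
        have := Nat.div_add_mod k n
        rw [mul_add, mul_one]
        omega
      rw [this, Nat.add_mul_mod_self_left, Nat.mod_eq_of_lt i.isLt]
    exact (hlim i _ y hi (hΔlim.mono_left (hshift _)) (hys _)).1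
  have hanti : Antitone fun k => klSum y (p k) :=
    antitone_nat_of_succ_le fun k => by linarith [hΔ y hyS k, hΔ0 k]
  have hD : Tendsto (fun k => klSum y (p k)) atTop (𝓝 0) := by
    -- Monotonicity upgrades the limit along `U` to a limit along `atTop`.
    have h1 := tendsto_atTop_ciInf hanti ⟨0, by rintro _ ⟨k, rfl⟩; exact hnn y hyS k⟩
    rwa [tendsto_nhds_unique (h1.mono_left hU) (tendsto_klSum_right hyU)] at h1
  refine ⟨y, hyS, ?_, fun x hx => ?_⟩
  · exact tendsto_right_of_klSum (fun _ => hS y hyS) hp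
      (Eventually.of_forall fun k => hdom y hyS k) hD tendsto_const_nhds (hS y hyS)
  · have h1 : ∀ k, klSum y (p 0) - klSum x (p 0) ≤ klSum y (p k) := fun k => by
      linarith [hgain x hx k, hgain y hyS k, hnn x hx k]
    linarith [ge_of_tendsto' hD h1]

/-! ### A single step of either kind -/

/-- One step of the cyclic scheme on the block `A x = b`: a GIS step for the normalized system if
`s` holds, and an exact KL projection otherwise. -/
def IsStep {m : ℕ} (s : Prop) (A : Matrix (Fin m) (Fin M) ℝ) (b : Fin m → ℝ) (ξ ξ' : ℝ)
    (p p' : Fin M → ℝ) : Prop :=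
  (s → p' = gisStep (normMatrix A b ξ ξ') (normRhs A b ξ ξ') p) ∧
    (¬ s → IsKLProj (affineSubset A b) p p')

/-- The amount by which one step of the cyclic scheme decreases the divergence from all points of
the affine subset. -/
noncomputable def stepGain {m : ℕ} (s : Prop) (A : Matrix (Fin m) (Fin M) ℝ) (b : Fin m → ℝ)
    (ξ ξ' : ℝ) (p p' : Fin M → ℝ) : ℝ :=
  open Classical in
  if s then klSum (normRhs A b ξ ξ') ((normMatrix A b ξ ξ').mulVec p) + (1 - ∑ j, p' j)
  else klSum p' p

section

variable {m : ℕ} {s : Prop} {A : Matrix (Fin m) (Fin M) ℝ} {b : Fin m → ℝ} {ξ ξ' : ℝ}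
  {p p' x : Fin M → ℝ}

theorem existsUnique_isStep (hp : ∀ j, 0 ≤ p j)
    (hx : x ∈ affineSubset A b) (hxp : ∀ j, p j = 0 → x j = 0) :
    ∃! p', IsStep s A b ξ ξ' p p' := by
  by_cases hs : s
  · exact ⟨_, ⟨fun _ => rfl, fun h => absurd hs h⟩, fun p' h => h.1 hs⟩
  · obtain ⟨z, hz, huniq⟩ := existsUnique_isKLProj affineSubset_nonneg (convex_affineSubset A b)
      (isCompact_affineSubset A b) hp ⟨x, hx, hxp⟩
    exact ⟨z, ⟨fun h => absurd h hs, fun _ => hz⟩, fun y hy => huniq y (hy.2 hs)⟩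

theorem IsStep.nonneg (h : IsStep s A b ξ ξ' p p') (hξ : s → IsAdmissible A b ξ ξ')
    (hp : ∀ j, 0 ≤ p j) (j : Fin M) : 0 ≤ p' j := by
  by_cases hs : s
  · rw [h.1 hs]
    exact (hξ hs).isNormalized.gisStep_nonneg hp j
  · exact affineSubset_nonneg _ (h.2 hs).1 j

theorem IsStep.sum_le_one (h : IsStep s A b ξ ξ' p p') (hξ : s → IsAdmissible A b ξ ξ')
    (hp : ∀ j, 0 ≤ p j) : ∑ j, p' j ≤ 1 := by
  by_cases hs : s
  · rw [h.1 hs]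
    exact (hξ hs).isNormalized.sum_gisStep_le hp
  · exact (h.2 hs).1.1.2.le

theorem IsStep.dominated (h : IsStep s A b ξ ξ' p p') (hξ : s → IsAdmissible A b ξ ξ')
    (hp : ∀ j, 0 ≤ p j) (hx : x ∈ affineSubset A b) (hxp : ∀ j, p j = 0 → x j = 0)
    (j : Fin M) (hj : p' j = 0) : x j = 0 := by
  by_cases hs : s
  · rw [h.1 hs] at hj
    exact (hξ hs).isNormalized.dominated_gisStep hp hx.1.1
      ((hξ hs).mem_affineSubset_iff.1 hx).2 hxp j hj
  · obtain ⟨h1, h2, h3⟩ := (isKLProj_iff affineSubset_nonneg hp ⟨x, hx, hxp⟩).1 (h.2 hs)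
    exact dominated_of_minimizer affineSubset_nonneg (convex_affineSubset A b) h1 h2 h3 hx
      hxp j hj

theorem IsStep.klSum_sub_klSum (h : IsStep s A b ξ ξ' p p') (hξ : s → IsAdmissible A b ξ ξ')
    (hp : ∀ j, 0 ≤ p j) (hx : x ∈ affineSubset A b) (hxp : ∀ j, p j = 0 → x j = 0) :
    klSum x p - klSum x p' = stepGain s A b ξ ξ' p p' := by
  unfold stepGain
  split_ifs with hs
  · rw [h.1 hs]
    exact (hξ hs).isNormalized.klSum_sub_klSum_gisStep hp hx.1.1
      ((hξ hs).mem_affineSubset_iff.1 hx).2 hxp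
  · obtain ⟨h1, h2, h3⟩ := (isKLProj_iff affineSubset_nonneg hp ⟨x, hx, hxp⟩).1 (h.2 hs)
    exact pythagoras_affineSubset hp h1 h2 h3 hx hxp

theorem klSum_normRhs_nonneg (hξ : IsAdmissible A b ξ ξ')
    (hp : ∀ j, 0 ≤ p j) (hx : x ∈ affineSubset A b) (hxp : ∀ j, p j = 0 → x j = 0) :
    0 ≤ klSum (normRhs A b ξ ξ') ((normMatrix A b ξ ξ').mulVec p) :=
  klSum_nonneg hξ.isNormalized.rhs_nonneg (hξ.isNormalized.mulVec_nonneg hp)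
    (hξ.isNormalized.rhs_eq_zero hp (hξ.mem_affineSubset_iff.1 hx).2 hxp)

theorem IsStep.gain_nonneg (h : IsStep s A b ξ ξ' p p') (hξ : s → IsAdmissible A b ξ ξ')
    (hp : ∀ j, 0 ≤ p j) (hx : x ∈ affineSubset A b) (hxp : ∀ j, p j = 0 → x j = 0) :
    0 ≤ stepGain s A b ξ ξ' p p' := by
  unfold stepGain
  split_ifs with hs
  · exact add_nonneg (klSum_normRhs_nonneg (hξ hs) hp hx hxp)
      (sub_nonneg.2 (h.sum_le_one hξ hp))
  · obtain ⟨h1, h2, -⟩ := (isKLProj_iff affineSubset_nonneg hp ⟨x, hx, hxp⟩).1 (h.2 hs)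
    exact klSum_nonneg (affineSubset_nonneg _ h1) hp h2

/-- If the gains of steps from `f` to `g` tend to zero and `f` converges, then the limit solves the
block system, and `g` converges to the same limit. -/
theorem tendsto_of_tendsto_stepGain {α : Type*} {l : Filter α} [l.NeBot] {f g : α → Fin M → ℝ}
    {y : Fin M → ℝ} (hξ : s → IsAdmissible A b ξ ξ')
    (hstep : ∀ᶠ k in l, IsStep s A b ξ ξ' (f k) (g k)) (hf : ∀ k j, 0 ≤ f k j)
    (hg : ∀ k j, 0 ≤ g k j)
    (hx : x ∈ affineSubset A b) (hxf : ∀ k j, f k j = 0 → x j = 0)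
    (hgain : Tendsto (fun k => stepGain s A b ξ ξ' (f k) (g k)) l (𝓝 0))
    (hy : Tendsto f l (𝓝 y)) : y ∈ affineSubset A b ∧ Tendsto g l (𝓝 y) := by
  have hy0 : ∀ j, 0 ≤ y j := fun j => ge_of_tendsto' (tendsto_pi_nhds.1 hy j) fun k => hf k j
  by_cases hs : s
  · have hN := (hξ hs).isNormalized
    have hxA := ((hξ hs).mem_affineSubset_iff.1 hx).2
    have h1 : Tendsto (fun k => klSum (normRhs A b ξ ξ') ((normMatrix A b ξ ξ').mulVec (f k))) l
        (𝓝 0) := by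
      refine squeeze_zero' (Eventually.of_forall fun k =>
        klSum_normRhs_nonneg (hξ hs) (hf k) hx (hxf k)) ?_ hgain
      filter_upwards [hstep] with k hk
      unfold stepGain
      rw [if_pos hs]
      -- The mass defect `1 - ∑ p'` is nonnegative, so the gain dominates `KL(b̂, Âp)`.
      linarith [hk.sum_le_one hξ (hf k)]
    have h2 := tendsto_right_of_klSum (fun _ => hN.rhs_nonneg)
      (fun k => hN.mulVec_nonneg (hf k))
      (Eventually.of_forall fun k => hN.rhs_eq_zero (hf k) hxA (hxf k)) h1 tendsto_const_nhds
      hN.rhs_nonneg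
    have h3 : Tendsto (fun k => (normMatrix A b ξ ξ').mulVec (f k)) l
        (𝓝 ((normMatrix A b ξ ξ').mulVec y)) :=
      ((Continuous.matrix_mulVec continuous_const continuous_id).tendsto y).comp hy
    have hyA := tendsto_nhds_unique h3 h2
    refine ⟨(hξ hs).mem_affineSubset_iff.2 ⟨hy0, hyA⟩, ?_⟩
    exact (hN.tendsto_gisStep hy0 hyA hy).congr' (hstep.mono fun k hk => (hk.1 hs).symm)
  · simp only [stepGain, if_neg hs] at hgain
    have h1 : Tendsto g l (𝓝 y) := tendsto_left_of_klSum hg hf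
      (hstep.mono fun k hk => ((isKLProj_iff affineSubset_nonneg (hf k) ⟨x, hx, hxf k⟩).1
        (hk.2 hs)).2.1) hgain hy hy0
    exact ⟨(isClosed_affineSubset A b).mem_of_tendsto h1
      (hstep.mono fun k hk => (hk.2 hs).1), h1⟩

end

/-! ### Runs of the cyclic scheme -/

section

variable {n : ℕ} [NeZero n] {m : Fin n → ℕ}
  {A : (k : Fin n) → Matrix (Fin (m k)) (Fin M) ℝ} {b : (k : Fin n) → Fin (m k) → ℝ}
  {q : Fin M → ℝ} {I : Set (Fin n)} {ξ ξ' : Fin n → ℝ}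

theorem isRun_iff {p : ℕ → Fin M → ℝ} :
    IsRun q I A b ξ ξ' p ↔ p 0 = q ∧ ∀ k, IsStep (Fin.ofNat n k ∈ I) (A (Fin.ofNat n k))
      (b (Fin.ofNat n k)) (ξ (Fin.ofNat n k)) (ξ' (Fin.ofNat n k)) (p k) (p (k + 1)) := by
  constructor
  · exact fun h => ⟨h.init, fun k => ⟨h.gis k _ rfl, h.proj k _ rfl⟩⟩
  · rintro ⟨h0, h⟩
    refine ⟨h0, ?_, ?_⟩
    · rintro k i rfl
      exact (h k).1
    · rintro k i rfl
      exact (h k).2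

theorem existsUnique_isRun (hq : ∀ j, 0 < q j)
    (hC : (⋂ k, affineSubset (A k) (b k)).Nonempty)
    (hξ : ∀ k ∈ I, IsAdmissible (A k) (b k) (ξ k) (ξ' k)) :
    ∃! p : ℕ → Fin M → ℝ, IsRun q I A b ξ ξ' p := by
  obtain ⟨x, hx⟩ := hC
  have hx' : ∀ i, x ∈ affineSubset (A i) (b i) := Set.mem_iInter.1 hx
  -- Domination of one fixed `x ∈ 𝒞` keeps a finite-divergence competitor available for every later
  -- projection.
  let T := {p : Fin M → ℝ // (∀ j, 0 ≤ p j) ∧ ∀ j, p j = 0 → x j = 0}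
  have hnext : ∀ (i : Fin n) (p : T), ∃ p' : T,
      IsStep (i ∈ I) (A i) (b i) (ξ i) (ξ' i) p.1 p'.1 := fun i p => by
    obtain ⟨p', hp', -⟩ := existsUnique_isStep (s := i ∈ I) (ξ := ξ i) (ξ' := ξ' i) p.2.1 (hx' i)
      p.2.2
    exact ⟨⟨p', hp'.nonneg (hξ i) p.2.1, hp'.dominated (hξ i) p.2.1 (hx' i) p.2.2⟩, hp'⟩
  choose next hnext using hnext
  let P : ℕ → T := fun k => Nat.rec
    (⟨q, fun j => (hq j).le, fun j hj => absurd hj (hq j).ne'⟩ : T)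
    (fun k p => next (Fin.ofNat n k) p) k
  refine ⟨fun k => (P k).1, isRun_iff.2 ⟨rfl, fun k => hnext _ (P k)⟩, fun p hp => ?_⟩
  obtain ⟨h0, hp⟩ := isRun_iff.1 hp
  funext k
  induction k with
  | zero => exact h0
  | succ k ih =>
    have h1 := hp k
    rw [ih] at h1
    exact (existsUnique_isStep (P k).2.1 (hx' _) (P k).2.2).unique h1 (hnext _ (P k))

theorem existsUnique_isKLProj_iInter (hq : ∀ j, 0 < q j)
    (hC : (⋂ k, affineSubset (A k) (b k)).Nonempty) :
    ∃! x : Fin M → ℝ, IsKLProj (⋂ k, affineSubset (A k) (b k)) q x := by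
  have hsub := Set.iInter_subset (fun k => affineSubset (A k) (b k)) 0
  exact existsUnique_isKLProj (fun x hx => affineSubset_nonneg x (hsub hx))
    (convex_iInter fun k => convex_affineSubset (A k) (b k))
    ((isCompact_affineSubset (A 0) (b 0)).of_isClosed_subset
      (isClosed_iInter fun k => isClosed_affineSubset (A k) (b k)) hsub)
    (fun j => (hq j).le) (hC.imp fun x hx => ⟨hx, fun j hj => absurd hj (hq j).ne'⟩)

theorem IsRun.tendsto {p : ℕ → Fin M → ℝ} (hp : IsRun q I A b ξ ξ' p) (hq : ∀ j, 0 < q j)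
    (hC : (⋂ k, affineSubset (A k) (b k)).Nonempty)
    (hξ : ∀ k ∈ I, IsAdmissible (A k) (b k) (ξ k) (ξ' k)) {x : Fin M → ℝ}
    (hx : IsKLProj (⋂ k, affineSubset (A k) (b k)) q x) : Tendsto p atTop (𝓝 x) := by
  obtain ⟨h0, hstep⟩ := isRun_iff.1 hp
  have hmem : ∀ z ∈ ⋂ k, affineSubset (A k) (b k), ∀ i, z ∈ affineSubset (A i) (b i) :=
    fun z hz => Set.mem_iInter.1 hz
  have hnn : ∀ k j, 0 ≤ p k j := fun k => by
    induction k with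
    | zero => exact fun j => h0 ▸ (hq j).le
    | succ k ih => exact (hstep k).nonneg (hξ _) ih
  have hdom : ∀ z ∈ ⋂ k, affineSubset (A k) (b k), ∀ k j, p k j = 0 → z j = 0 := fun z hz k => by
    induction k with
    | zero => exact fun j hj => absurd hj (h0 ▸ (hq j).ne')
    | succ k ih => exact (hstep k).dominated (hξ _) (hnn k) (hmem z hz _) ih
  -- The starting point `q` need not have mass at most `1`; all later iterates do.
  have hbound : ∀ k j, p k j ≤ max (∑ j, q j) 1 := fun k j => by
    refine (Finset.single_le_sum (fun j _ => hnn k j) (Finset.mem_univ j)).trans ?_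
    rcases k with _ | k
    · exact h0 ▸ le_max_left _ _
    · exact ((hstep k).sum_le_one (hξ _) (hnn k)).trans (le_max_right _ _)
  have hzC := hC.choose_spec
  obtain ⟨y, hy, hlim, hmin⟩ := exists_tendsto_of_equal_gain
    (S := fun i => affineSubset (A i) (b i)) (p := p)
    (Δ := fun k => stepGain (Fin.ofNat n k ∈ I) (A (Fin.ofNat n k)) (b (Fin.ofNat n k))
      (ξ (Fin.ofNat n k)) (ξ' (Fin.ofNat n k)) (p k) (p (k + 1)))
    hnn hbound hC (fun z hz => affineSubset_nonneg z (hmem z hz 0)) hdom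
    (fun k => (hstep k).gain_nonneg (hξ _) (hnn k) (hmem _ hzC _) (hdom _ hzC k))
    (fun z hz k => (hstep k).klSum_sub_klSum (hξ _) (hnn k) (hmem z hz _) (hdom z hz k))
    (fun i F _ y hi hgain hy => by
      refine tendsto_of_tendsto_stepGain (g := fun k => p (k + 1)) (hξ i) ?_ hnn
        (fun k => hnn (k + 1)) (hmem _ hzC i)
        (hdom _ hzC) (hgain.congr' ?_) hy
      · filter_upwards [hi] with k hk
        exact hk ▸ hstep k
      · filter_upwards [hi] with k hk
        rw [hk])
  have hproj : IsKLProj (⋂ k, affineSubset (A k) (b k)) q y :=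
    (isKLProj_iff (fun z hz => affineSubset_nonneg z (hmem z hz 0)) (fun j => (hq j).le)
      ⟨y, hy, fun j hj => absurd hj (hq j).ne'⟩).2
      ⟨hy, fun j hj => absurd hj (hq j).ne', fun z hz _ => h0 ▸ hmin z hz⟩
  rwa [(existsUnique_isKLProj_iInter hq hC).unique hx hproj]

end

end KLMix

theorem theorem1 {n M : ℕ} [NeZero n] (m : Fin n → ℕ)
    (A : (k : Fin n) → Matrix (Fin (m k)) (Fin M) ℝ) (b : (k : Fin n) → Fin (m k) → ℝ)
    (q : Fin M → ℝ) (hq : ∀ j, 0 < q j)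
    (hC : (⋂ k, KLMix.affineSubset (A k) (b k)).Nonempty)
    (I : Set (Fin n)) (ξ ξ' : Fin n → ℝ)
    (hξ : ∀ k ∈ I, KLMix.IsAdmissible (A k) (b k) (ξ k) (ξ' k)) :
    (∃! p : ℕ → Fin M → ℝ, KLMix.IsRun q I A b ξ ξ' p) ∧
    (∃! x : Fin M → ℝ, KLMix.IsKLProj (⋂ k, KLMix.affineSubset (A k) (b k)) q x) ∧
    ∀ (p : ℕ → Fin M → ℝ) (x : Fin M → ℝ), KLMix.IsRun q I A b ξ ξ' p →
      KLMix.IsKLProj (⋂ k, KLMix.affineSubset (A k) (b k)) q x →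
      Tendsto p atTop (𝓝 x) :=
  ⟨KLMix.existsUnique_isRun hq hC hξ, KLMix.existsUnique_isKLProj_iInter hq hC,
    fun _ _ hp hx => hp.tendsto hq hC hξ hx⟩
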